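/- Let $X$ be a compact oriented smooth manifold of odd dimension $m$ with boundary $\partial X$, and give $\partial X$ the boundary orientation. For a smooth Riemannian metric $g$ on $X$ with Levi-Civita connection $\nabla^{TX}$, let $e_m$ be the inward-pointing unit normal along $\partial X$, let $e_1,\dots,e_{m-1}$ be a local orthonormal frame of $T\partial X$ for the induced metric, and let $e_1^*,\dots,e_m^*$ be the dual coframe. In the $\mathbb{Z}_2$-graded tensor product $\Lambda T^*\partial X\,\widehat\otimes\,\widehat{\Lambda T^*\partial X}$, where hats mark elements of the second factor, put $$\dot R:=\tfrac12\sum_{1\le k,j\le m-1}\langle e_k,R^{T\partial X}e_j\rangle\,\widehat{e_k^*}\wedge\widehat{e_j^*},\qquad \dot S:=\tfrac12\, j^*\nabla^{TX}\widehat{e_m^*}=\tfrac12\sum_{1\le a,b\le m-1}(\nabla^{TX}_{e_a}e_m^*)(e_b)\;e_a^*\wedge\widehat{e_b^*},$$ where $R^{T\partial X}$ is the curvature of the Levi-Civita connection of the induced metric on $\partial X$ and $j:\partial X\hookrightarrow X$ is the inclusion. Let $\int^{B_{\partial X}}:\Lambda T^*\partial X\,\widehat\otimes\,\widehat{\Lambda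 T^*\partial X}\to\Lambda T^*\partial X$ be the Berezin integral of the oriented Euclidean bundle $T\partial X$, of rank $n=m-1$: it sends $\alpha\wedge\widehat\beta$ to $(-1)^{n(n+1)/2}\pi^{-n/2}\,\beta(e_1,\dots,e_n)\,\alpha$ if $\deg\beta=n$ and $(e_1,\dots,e_n)$ is positively oriented, and to $0$ if $\deg\beta\ne n$. The Brüning–Ma secondary class of $g$ is the differential form on $\partial X$ $$B(\nabla^{TX}):=\int^{B_{\partial X}}\exp\!\left(-\tfrac12\dot R\right)\sum_{k=1}^{\infty}\frac{(-\dot S^2)^k}{4k\,\Gamma(k+1)} .$$ **Proposition (Scaling).** Let $g_1$ be a smooth Riemannian metric on $X$, let $s>0$ and put $g_2=s\cdot g_1$. Let $\nabla^{TX}_1,\nabla^{TX}_2$ be the corresponding Levi-Civita connections. Then $B(\nabla^{TX}_1)=B(\nabla^{TX}_2)$ as differential forms on $\partial X$. -/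

import Mathlib

open scoped Manifold ContDiff TensorProduct

noncomputable section

namespace BoundaryAnomaly

/-- Coordinate space `ℝ^d`. -/
abbrev Coord (d : ℕ) : Type := EuclideanSpace ℝ (Fin d)

section BoundaryManifold

variable (n : ℕ) (X : Type*) [TopologicalSpace X] [ChartedSpace (EuclideanHalfSpace (n + 1)) X]

/-- The boundary `∂X` of a manifold `X` of dimension `n + 1`. -/
abbrev Boundary : Type _ := ↥((𝓡∂ (n + 1)).boundary X)

variable {n}

/-- The coordinates other than the zeroth one of a point of the half-space `{v_0 ≥ 0}`. -/
def tailCoord (v : EuclideanHalfSpace (n + 1)) : Coord n :=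
  WithLp.toLp 2 fun i => v.1 i.succ

/-- The point `(0, u)` of the wall of the half-space. -/
def wallPoint (u : Coord n) : EuclideanHalfSpace (n + 1) :=
  ⟨WithLp.toLp 2 (Fin.cons 0 u), by simp⟩

lemma continuous_tailCoord : Continuous (tailCoord (n := n)) := by
  unfold tailCoord
  refine (PiLp.continuous_toLp 2 _).comp (continuous_pi fun i => ?_)
  exact (PiLp.continuous_apply 2 _ _).comp continuous_subtype_val

lemma continuous_wallPoint : Continuous (wallPoint (n := n)) := by
  unfold wallPoint
  refine Continuous.subtype_mk ((PiLp.continuous_toLp 2 _).comp (continuous_pi fun i => ?_)) _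
  refine Fin.cases ?_ (fun i => ?_) i
  · simpa using continuous_const
  · simpa using PiLp.continuous_apply 2 _ i

lemma tailCoord_wallPoint (u : Coord n) : tailCoord (wallPoint u) = u := by
  ext i; simp [tailCoord, wallPoint]

lemma wallPoint_tailCoord (v : EuclideanHalfSpace (n + 1)) (hv : v.1 0 = 0) :
    wallPoint (tailCoord v) = v := by
  apply EuclideanHalfSpace.ext
  ext i
  refine Fin.cases ?_ (fun i => ?_) i
  · simp [wallPoint, hv]
  · simp [tailCoord, wallPoint]

variable {X} [IsManifold (𝓡∂ (n + 1)) ∞ X]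

lemma mem_boundary_iff (p : X) {x : X}
    (hx : x ∈ (chartAt (EuclideanHalfSpace (n + 1)) p).source) :
    x ∈ (𝓡∂ (n + 1)).boundary X ↔ (chartAt (EuclideanHalfSpace (n + 1)) p x).1 0 = 0 := by
  set e := chartAt (EuclideanHalfSpace (n + 1)) p
  have h := (𝓡∂ (n + 1)).isInteriorPoint_iff_of_mem_atlas (M := X) (n := ∞) (by simp)
    (chart_mem_atlas _ p) hx
  have h2 : e.extend (𝓡∂ (n + 1)) x ∈ interior (e.extend (𝓡∂ (n + 1))).target ↔
      0 < (e x).1 0 := by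
    constructor
    · intro h
      have h' := e.interior_extend_target_subset_interior_range (I := 𝓡∂ (n + 1)) h
      rw [interior_range_modelWithCornersEuclideanHalfSpace] at h'
      exact h'
    · intro h
      refine e.mem_interior_extend_target (e.map_source hx) ?_
      rw [interior_range_modelWithCornersEuclideanHalfSpace]
      exact h
  have h3 : x ∈ (𝓡∂ (n + 1)).boundary X ↔ ¬ (𝓡∂ (n + 1)).IsInteriorPoint x :=
    ModelWithCorners.isBoundaryPoint_iff_not_isInteriorPoint x
  rw [h3, h, h2]
  have := (e x).2
  constructor
  · intro h; linarith
  · intro h; linarith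

open Classical in
/-- The chart of the boundary obtained by restriction of the preferred chart of `X` at `p`. -/
def boundaryChart (p : Boundary n X) : OpenPartialHomeomorph (Boundary n X) (Coord n) where
  toFun x := tailCoord (chartAt (EuclideanHalfSpace (n + 1)) p.1 x.1)
  invFun u :=
    if hu : (chartAt (EuclideanHalfSpace (n + 1)) p.1).symm (wallPoint u) ∈
      (𝓡∂ (n + 1)).boundary X then ⟨_, hu⟩ else p
  source := Subtype.val ⁻¹' (chartAt (EuclideanHalfSpace (n + 1)) p.1).source
  target := wallPoint ⁻¹' (chartAt (EuclideanHalfSpace (n + 1)) p.1).target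
  map_source' x hx := by
    have h := (mem_boundary_iff p.1 hx).1 x.2
    simpa [wallPoint_tailCoord _ h] using
      (chartAt (EuclideanHalfSpace (n + 1)) p.1).map_source hx
  map_target' u hu := by
    have hs := (chartAt (EuclideanHalfSpace (n + 1)) p.1).map_target hu
    have h := (mem_boundary_iff p.1 hs).2
      (by rw [OpenPartialHomeomorph.right_inv _ hu]; simp [wallPoint])
    simpa [h] using hs
  left_inv' x hx := by
    have h := (mem_boundary_iff p.1 hx).1 x.2
    have h2 : (chartAt (EuclideanHalfSpace (n + 1)) p.1).symm
        (wallPoint (tailCoord (chartAt (EuclideanHalfSpace (n + 1)) p.1 x.1))) = x.1 := by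
      rw [wallPoint_tailCoord _ h, OpenPartialHomeomorph.left_inv _ hx]
    have h3 := x.2
    rw [← h2] at h3
    rw [dif_pos h3]
    exact Subtype.ext h2
  right_inv' u hu := by
    have hs := (chartAt (EuclideanHalfSpace (n + 1)) p.1).map_target hu
    have h := (mem_boundary_iff p.1 hs).2
      (by rw [OpenPartialHomeomorph.right_inv _ hu]; simp [wallPoint])
    rw [dif_pos h]
    simp only
    rw [OpenPartialHomeomorph.right_inv _ hu, tailCoord_wallPoint]
  open_source := (chartAt _ p.1).open_source.preimage continuous_subtype_val
  open_target := (chartAt _ p.1).open_target.preimage continuous_wallPoint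
  continuousOn_toFun := continuous_tailCoord.comp_continuousOn
    ((chartAt (EuclideanHalfSpace (n + 1)) p.1).continuousOn.comp
      continuous_subtype_val.continuousOn fun _ h => h)
  continuousOn_invFun := by
    rw [Topology.IsInducing.subtypeVal.continuousOn_iff]
    refine ((chartAt (EuclideanHalfSpace (n + 1)) p.1).continuousOn_symm.comp
      continuous_wallPoint.continuousOn fun _ h => h).congr fun u hu => ?_
    have hs := (chartAt (EuclideanHalfSpace (n + 1)) p.1).map_target hu
    have h := (mem_boundary_iff p.1 hs).2
      (by rw [OpenPartialHomeomorph.right_inv _ hu]; simp [wallPoint])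
    simp [h]

lemma boundaryChart_symm_val (p : Boundary n X) {u : Coord n}
    (hu : wallPoint u ∈ (chartAt (EuclideanHalfSpace (n + 1)) p.1).target) :
    ((boundaryChart p).symm u).1 =
      (chartAt (EuclideanHalfSpace (n + 1)) p.1).symm (wallPoint u) := by
  have hs := (chartAt (EuclideanHalfSpace (n + 1)) p.1).map_target hu
  have h := (mem_boundary_iff p.1 hs).2
    (by rw [OpenPartialHomeomorph.right_inv _ hu]; simp [wallPoint])
  exact congrArg Subtype.val (dif_pos h)

/-- The boundary as a manifold of dimension `n`, through restricted charts of `X`. -/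
instance boundaryChartedSpace : ChartedSpace (Coord n) (Boundary n X) where
  atlas := Set.range boundaryChart
  chartAt := boundaryChart
  mem_chart_source p := mem_chart_source (EuclideanHalfSpace (n + 1)) p.1
  chart_mem_atlas p := ⟨p, rfl⟩

/-- The boundary is a smooth manifold. -/
instance boundaryIsManifold : IsManifold (𝓡 n) ∞ (Boundary n X) := by
  apply isManifold_of_contDiffOn
  rintro _ _ ⟨p, rfl⟩ ⟨q, rfl⟩
  have h := (𝓡∂ (n + 1)).contDiffOn_extendCoordChange (n := ∞)
    (IsManifold.chart_mem_maximalAtlas (I := 𝓡∂ (n + 1)) (n := ∞) p.1)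
    (IsManifold.chart_mem_maximalAtlas (I := 𝓡∂ (n + 1)) (n := ∞) q.1)
  have hw : ContDiff ℝ ∞ fun u : Coord n => (wallPoint u).1 := by
    unfold wallPoint
    rw [contDiff_euclidean]
    refine Fin.cases ?_ fun i => ?_
    · simpa using contDiff_const
    · simp; fun_prop
  have ht : ContDiff ℝ ∞ fun v : Coord (n + 1) => (WithLp.toLp 2 fun i : Fin n => v i.succ : Coord n) := by
    rw [contDiff_euclidean]
    intro i
    simp; fun_prop
  have key : ∀ u ∈ (𝓡 n).symm ⁻¹' ((boundaryChart p).symm ≫ₕ boundaryChart q).source ∩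
      Set.range (𝓡 n), wallPoint u ∈ (chartAt (EuclideanHalfSpace (n + 1)) p.1).target ∧
        (chartAt (EuclideanHalfSpace (n + 1)) p.1).symm (wallPoint u) ∈
          (chartAt (EuclideanHalfSpace (n + 1)) q.1).source := by
    rintro u ⟨⟨h1, h2⟩, -⟩
    refine ⟨h1, ?_⟩
    have h3 : ((boundaryChart p).symm u).1 ∈
      (chartAt (EuclideanHalfSpace (n + 1)) q.1).source := h2
    exact boundaryChart_symm_val p h1 ▸ h3
  refine (ht.comp_contDiffOn (h.comp hw.contDiffOn ?_)).congr ?_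
  · intro u hu
    rw [ModelWithCorners.extendCoordChange_source]
    refine ⟨wallPoint u, ⟨(key u hu).1, (key u hu).2⟩, rfl⟩
  · intro u hu
    have h1 := boundaryChart_symm_val p (key u hu).1
    have h2 : (𝓡∂ (n + 1)).symm (wallPoint u).1 = wallPoint u :=
      (𝓡∂ (n + 1)).left_inv (wallPoint u)
    change tailCoord (chartAt (EuclideanHalfSpace (n + 1)) q.1
      ((boundaryChart p).symm u).1) = tailCoord (chartAt (EuclideanHalfSpace (n + 1)) q.1
        ((chartAt (EuclideanHalfSpace (n + 1)) p.1).symm ((𝓡∂ (n + 1)).symm (wallPoint u).1)))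
    rw [h1, h2]


/-- The linear map `v ↦ (0, v)`. -/
def wallCLM (n : ℕ) : Coord n →L[ℝ] Coord (n + 1) :=
  LinearMap.toContinuousLinearMap
    { toFun := fun v => WithLp.toLp 2 (Fin.cons 0 v)
      map_add' := fun v w => by
        ext i; refine Fin.cases ?_ (fun i => ?_) i <;> simp
      map_smul' := fun c v => by
        ext i; refine Fin.cases ?_ (fun i => ?_) i <;> simp }

lemma hasMFDerivAt_boundary_val (y : Boundary n X) :
    HasMFDerivAt (𝓡 n) (𝓡∂ (n + 1)) (Subtype.val : Boundary n X → X) y (wallCLM n) := by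
  refine ⟨continuous_subtype_val.continuousAt, ?_⟩
  have h0 : HasFDerivWithinAt (fun u : Coord n => (wallPoint u).1) (wallCLM n)
      (Set.range (𝓡 n)) (extChartAt (𝓡 n) y y) := by
    have : (fun u : Coord n => (wallPoint u).1) = wallCLM n := rfl
    rw [this]
    exact (wallCLM n).hasFDerivWithinAt
  have hy : extChartAt (𝓡 n) y y ∈ (boundaryChart y).target :=
    (boundaryChart y).map_source (mem_chart_source (EuclideanHalfSpace (n + 1)) y.1)
  have key : ∀ u ∈ (boundaryChart y).target,
      writtenInExtChartAt (𝓡 n) (𝓡∂ (n + 1)) y (Subtype.val : Boundary n X → X) u =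
        (wallPoint u).1 := by
    intro u hu
    change (chartAt (EuclideanHalfSpace (n + 1)) y.1 ((boundaryChart y).symm u).1).1 = _
    have hu' : wallPoint u ∈ (chartAt (EuclideanHalfSpace (n + 1)) y.1).target := hu
    rw [boundaryChart_symm_val y hu', OpenPartialHomeomorph.right_inv _ hu']
  refine h0.congr_of_eventuallyEq ?_ (key _ hy)
  exact Filter.eventually_of_mem
    (mem_nhdsWithin_of_mem_nhds ((boundaryChart y).open_target.mem_nhds hy)) key

end BoundaryManifold

section LeviCivita

/-- A (not necessarily smooth) family of bilinear forms on the tangent spaces of `M`. -/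
abbrev BilinField {d : ℕ} {H : Type*} [TopologicalSpace H] (I : ModelWithCorners ℝ (Coord d) H)
    (M : Type*) [TopologicalSpace M] [ChartedSpace H M] : Type _ :=
  ∀ x : M, LinearMap.BilinForm ℝ (TangentSpace I x)

variable {d : ℕ} {H : Type*} [TopologicalSpace H] {M : Type*} [TopologicalSpace M]
  [ChartedSpace H M] {I : ModelWithCorners ℝ (Coord d) H}

/-- The coefficients `g_{ij}(u) = g(∂_i, ∂_j)` of `g` in the preferred chart at `p`, as functions
of the coordinate point `u`. -/
def metricCoeff (g : BilinField I M) (p : M) (u : Coord d) : Matrix (Fin d) (Fin d) ℝ :=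
  let D := mfderivWithin 𝓘(ℝ, Coord d) I (extChartAt I p).symm (Set.range I) u
  Matrix.of fun i j => g ((extChartAt I p).symm u)
    (D (EuclideanSpace.single i 1)) (D (EuclideanSpace.single j 1))

variable (I) in
/-- The partial derivative `∂_i f` at `u` (one-sided at the edge of the model). -/
def coordDeriv (i : Fin d) (f : Coord d → ℝ) (u : Coord d) : ℝ :=
  fderivWithin ℝ f (Set.range I) u (EuclideanSpace.single i 1)

/-- The Christoffel symbols `Γ^k_{ij}` of the Levi-Civita connection of `g`, that is
`∇_{∂_i} ∂_j = ∑ k, Γ^k_{ij} ∂_k`, in the preferred chart at `p`. -/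
def christoffel (g : BilinField I M) (p : M) (k i j : Fin d) (u : Coord d) : ℝ :=
  (1 / 2) * ∑ l, (metricCoeff g p u)⁻¹ k l *
    (coordDeriv I i (fun z => metricCoeff g p z j l) u
      + coordDeriv I j (fun z => metricCoeff g p z i l) u
      - coordDeriv I l (fun z => metricCoeff g p z i j) u)

/-- The coefficients of the curvature `R = ∇²` of the Levi-Civita connection:
`R(∂_i, ∂_j) ∂_k = ∑ l, R^l_{ijk} ∂_l`. -/
def curvatureCoeff (g : BilinField I M) (p : M) (l i j k : Fin d) (u : Coord d) : ℝ :=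
  coordDeriv I i (christoffel g p l j k) u - coordDeriv I j (christoffel g p l i k) u
    + ∑ a, (christoffel g p l i a u * christoffel g p a j k u
      - christoffel g p l j a u * christoffel g p a i k u)

/-- The coordinates of a tangent vector at `p` in the preferred chart at `p`. -/
def tangentCoord (p : M) (v : TangentSpace I p) (i : Fin d) : ℝ :=
  (show Coord d from v) i

/-- The tangent vector at `p` with given coordinates in the preferred chart at `p`. -/
def tangentVec (p : M) (c : Fin d → ℝ) : TangentSpace I p :=
  show Coord d from WithLp.toLp 2 c

/-- The curvature operator `R(v, w) z` of the Levi-Civita connection of `g` at `p`. -/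
def curvature (g : BilinField I M) (p : M) (v w z : TangentSpace I p) : TangentSpace I p :=
  tangentVec p fun l => ∑ i, ∑ j, ∑ k,
    tangentCoord p v i * tangentCoord p w j * tangentCoord p z k *
      curvatureCoeff g p l i j k (extChartAt I p p)

/-- The coefficients `(∇_{∂_i} θ)_j` of the covariant derivative of a one-form `θ = ∑ j, θ_j dx^j`
for the Levi-Civita connection of `g`, in the preferred chart at `p`. -/
def covDerivForm (g : BilinField I M) (p : M) (θ : Fin d → Coord d → ℝ) (i j : Fin d)
    (u : Coord d) : ℝ :=
  coordDeriv I i (θ j) u - ∑ k, christoffel g p k i j u * θ k u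

end LeviCivita

section Boundary

variable {n : ℕ} {X : Type*} [TopologicalSpace X] [ChartedSpace (EuclideanHalfSpace (n + 1)) X]
  [IsManifold (𝓡∂ (n + 1)) ∞ X]

variable (n X) in
/-- Smooth Riemannian metrics on `X`. -/
abbrev SmoothMetric : Type _ :=
  Bundle.ContMDiffRiemannianMetric (𝓡∂ (n + 1)) ∞ (Coord (n + 1))
    (fun x : X => TangentSpace (𝓡∂ (n + 1)) x)

variable (n X) in
/-- An orientation of the manifold `X`: an orientation of every tangent space, which is locally
constant when the tangent spaces are identified through a chart. -/
structure ManifoldOrientation where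
  /-- The orientation of each tangent space. -/
  orient : ∀ x : X, Orientation ℝ (TangentSpace (𝓡∂ (n + 1)) x) (Fin (n + 1))
  locallyConstant : ∀ x₀ : X, ∃ o : Orientation ℝ (Coord (n + 1)) (Fin (n + 1)),
    ∀ᶠ x in nhds x₀, ∃ L : TangentSpace (𝓡∂ (n + 1)) x ≃ₗ[ℝ] Coord (n + 1),
      (∀ v, L v = mfderiv (𝓡∂ (n + 1)) 𝓘(ℝ, Coord (n + 1))
        (extChartAt (𝓡∂ (n + 1)) x₀) x v) ∧
      Orientation.map (Fin (n + 1)) L (orient x) = o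

/-- The differential at `y` of the inclusion of the boundary, `T_y∂X → T_yX`. -/
def boundaryInclusion (y : Boundary n X) :
    TangentSpace (𝓡 n) y →L[ℝ] TangentSpace (𝓡∂ (n + 1)) y.1 :=
  mfderiv (𝓡 n) (𝓡∂ (n + 1)) (Subtype.val : Boundary n X → X) y

/-- The bilinear forms underlying a Riemannian metric. -/
def metricForm (g : SmoothMetric n X) : BilinField (𝓡∂ (n + 1)) X := fun x =>
  LinearMap.mk₂ ℝ (fun v w => g.inner x v w)
    (fun _ _ _ => by simp) (fun _ _ _ => by simp) (fun _ _ _ => by simp) (fun _ _ _ => by simp)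

/-- The metric induced on the boundary by the metric `g` of `X`. -/
def boundaryMetric (g : SmoothMetric n X) : BilinField (𝓡 n) (Boundary n X) := fun y =>
  (metricForm g y.1).compl₁₂ (boundaryInclusion y).toLinearMap (boundaryInclusion y).toLinearMap

lemma boundaryInclusion_injective (y : Boundary n X) :
    Function.Injective (boundaryInclusion y) := by
  unfold boundaryInclusion
  rw [(hasMFDerivAt_boundary_val y).mfderiv]
  intro v w h
  have h' : ∀ i : Fin (n + 1), (Fin.cons 0 (show Coord n from v) : Fin (n + 1) → ℝ) i =
      (Fin.cons 0 (show Coord n from w) : Fin (n + 1) → ℝ) i := fun i =>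
    congrArg (fun z : Coord (n + 1) => z i) h
  have : (show Coord n from v) = (show Coord n from w) := by
    ext i; simpa using h' i.succ
  exact this

/-- `e` is an orthonormal basis of `T_y∂X`. -/
def IsOrthonormalFrame (g : SmoothMetric n X) (y : Boundary n X)
    (e : Module.Basis (Fin n) ℝ (TangentSpace (𝓡 n) y)) : Prop :=
  ∀ i j, boundaryMetric g y (e i) (e j) = if i = j then 1 else 0

lemma exists_orthonormalFrame (g : SmoothMetric n X) (y : Boundary n X) :
    ∃ e : Module.Basis (Fin n) ℝ (TangentSpace (𝓡 n) y), IsOrthonormalFrame g y e := by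
  let V := TangentSpace (𝓡 n) y
  have : FiniteDimensional ℝ V := inferInstanceAs (FiniteDimensional ℝ (Coord n))
  have hdim : Module.finrank ℝ V = n := finrank_euclideanSpace_fin (𝕜 := ℝ) (n := n)
  let B : LinearMap.BilinForm ℝ V := boundaryMetric g y
  have hsymm : LinearMap.IsSymm B := ⟨fun v w => g.symm y.1 _ _⟩
  obtain ⟨b, hb⟩ := LinearMap.BilinForm.exists_orthogonal_basis (K := ℝ) (V := V) (B := B) hsymm
  have hpos : ∀ i, 0 < B (b i) (b i) := fun i =>
    g.pos y.1 _ fun h => b.ne_zero i (boundaryInclusion_injective y (h.trans (map_zero _).symm))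
  have hu : ∀ i, IsUnit ((√(B (b i) (b i)))⁻¹) := fun i =>
    (inv_ne_zero (Real.sqrt_pos.2 (hpos i)).ne').isUnit
  refine ⟨(b.isUnitSMul hu).reindex (finCongr hdim), fun i j => ?_⟩
  set i' := (finCongr hdim).symm i with hi'
  set j' := (finCongr hdim).symm j with hj'
  have h1 : boundaryMetric g y (((b.isUnitSMul hu).reindex (finCongr hdim)) i)
      (((b.isUnitSMul hu).reindex (finCongr hdim)) j) =
      (√(B (b i') (b i')))⁻¹ * ((√(B (b j') (b j')))⁻¹ * B (b i') (b j')) := by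
    rw [Module.Basis.reindex_apply, Module.Basis.reindex_apply, Module.Basis.isUnitSMul_apply,
      Module.Basis.isUnitSMul_apply]
    change B _ _ = _
    simp [i', j']
    ring
  rw [h1]
  by_cases hij : i = j
  · subst hij
    have := Real.mul_self_sqrt (hpos i').le
    have h3 := (Real.sqrt_pos.2 (hpos i')).ne'
    rw [if_pos rfl]
    change (√(B (b i') (b i')))⁻¹ * ((√(B (b i') (b i')))⁻¹ * B (b i') (b i')) = 1
    field_simp
    nlinarith
  · have h2 : i' ≠ j' := fun h => hij ((finCongr hdim).symm.injective h)
    rw [if_neg hij, hb h2]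
    simp

/-- Coordinates of the unit normal field along the boundary: the normalized gradient of the
coordinate `x_0`. Since `X` is `{x_0 ≥ 0}` in a chart, it is the inward-pointing one. -/
def unitNormalCoeff (g : SmoothMetric n X) (p : X) (k : Fin (n + 1)) (u : Coord (n + 1)) : ℝ :=
  (metricCoeff (metricForm g) p u)⁻¹ k 0 /
    √((metricCoeff (metricForm g) p u)⁻¹ 0 0)

/-- The inward-pointing unit normal vector `e_m` at a boundary point. -/
def unitNormal (g : SmoothMetric n X) (y : Boundary n X) : TangentSpace (𝓡∂ (n + 1)) y.1 :=
  tangentVec y.1 fun k => unitNormalCoeff g y.1 k (extChartAt (𝓡∂ (n + 1)) y.1 y.1)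

/-- Coordinates of the dual covector `e_m^* = g(e_m, ·)` of the unit normal field. -/
def unitConormalCoeff (g : SmoothMetric n X) (p : X) (j : Fin (n + 1)) (u : Coord (n + 1)) : ℝ :=
  ∑ k, metricCoeff (metricForm g) p u j k * unitNormalCoeff g p k u

/-- `(∇^{TX}_v e_m^*)(w)` for `v, w` tangent to the boundary. -/
def normalDeriv (g : SmoothMetric n X) (y : Boundary n X) (v w : TangentSpace (𝓡 n) y) : ℝ :=
  ∑ i, ∑ j, tangentCoord y.1 (boundaryInclusion y v) i *
    tangentCoord y.1 (boundaryInclusion y w) j *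
    covDerivForm (metricForm g) y.1 (unitConormalCoeff g y.1) i j
      (extChartAt (𝓡∂ (n + 1)) y.1 y.1)

open Classical in
/-- `1` if the basis `e` of `T_y∂X` is positive for the boundary orientation (outward normal
first), and `-1` otherwise. -/
def frameSign (o : ManifoldOrientation n X) (g : SmoothMetric n X) (y : Boundary n X)
    (e : Module.Basis (Fin n) ℝ (TangentSpace (𝓡 n) y)) : ℝ :=
  if ∃ b : Module.Basis (Fin (n + 1)) ℝ (TangentSpace (𝓡∂ (n + 1)) y.1),
      b 0 = -unitNormal g y ∧ (∀ i, b i.succ = boundaryInclusion y (e i)) ∧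
        b.orientation = o.orient y.1
  then 1 else -1

end Boundary

section Berezin

/-- The graded tensor product `Λ V ⊗̂ Λ V`; the second factor is the one that carries hats. -/
abbrev DoubleExterior (V : Type*) [AddCommGroup V] [Module ℝ V] : Type _ :=
  (fun i : ℕ => ⋀[ℝ]^i V) ᵍ⊗[ℝ] (fun i : ℕ => ⋀[ℝ]^i V)

/-- The element `α β̂` of `Λ V ⊗̂ Λ V`. -/
def hatMul {V : Type*} [AddCommGroup V] [Module ℝ V] (α β : ExteriorAlgebra ℝ V) :
    DoubleExterior V :=
  GradedTensorProduct.tmul ℝ α β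

/-- The exponential series; it is a finite sum on nilpotent elements. -/
def nilExp {A : Type*} [Ring A] [Module ℝ A] (a : A) : A :=
  ∑ᶠ k : ℕ, ((k.factorial : ℝ)⁻¹) • a ^ k

variable {n : ℕ} {V : Type*} [AddCommGroup V] [Module ℝ V]

/-- Evaluation `β ↦ β(e_1, …, e_n)` on forms of degree `n`, and zero on the other degrees. -/
def topEval (e : Module.Basis (Fin n) ℝ V) :
    ExteriorAlgebra ℝ (Module.Dual ℝ V) →ₗ[ℝ] ℝ :=
  ExteriorAlgebra.liftAlternating fun i =>
    if h : n = i then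
      h ▸ (Matrix.detRowAlternating (R := ℝ) (n := Fin n)).compLinearMap
        (LinearMap.pi fun j => Module.Dual.eval ℝ V (e j))
    else 0

/-- The Berezin integral for the basis `e`, whose sign with respect to the orientation is `ε`:
`α β̂ ↦ (-1)^{n(n+1)/2} π^{-n/2} ε β(e_1, …, e_n) α`. -/
def berezin (e : Module.Basis (Fin n) ℝ V) (ε : ℝ) :
    DoubleExterior (Module.Dual ℝ V) →ₗ[ℝ] ExteriorAlgebra ℝ (Module.Dual ℝ V) :=
  ((-1) ^ (n * (n + 1) / 2) * Real.pi ^ (-(n : ℝ) / 2) * ε) •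
    ((TensorProduct.rid ℝ (ExteriorAlgebra ℝ (Module.Dual ℝ V))).toLinearMap ∘ₗ
      TensorProduct.map LinearMap.id (topEval e) ∘ₗ
      (GradedTensorProduct.of ℝ (fun i : ℕ => ⋀[ℝ]^i (Module.Dual ℝ V))
        (fun i : ℕ => ⋀[ℝ]^i (Module.Dual ℝ V))).symm.toLinearMap)

end Berezin

section SecondaryClass

variable {n : ℕ} {X : Type*} [TopologicalSpace X] [ChartedSpace (EuclideanHalfSpace (n + 1)) X]
  [IsManifold (𝓡∂ (n + 1)) ∞ X]

/-- The element `e^k` of the dual basis, in the exterior algebra of `T_y^*∂X`. -/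
def coframe {y : Boundary n X} (e : Module.Basis (Fin n) ℝ (TangentSpace (𝓡 n) y)) (k : Fin n) :
    ExteriorAlgebra ℝ (Module.Dual ℝ (TangentSpace (𝓡 n) y)) :=
  ExteriorAlgebra.ι ℝ (e.coord k)

/-- The two-form `⟨e_k, R^{T∂X} e_j⟩`, whose value on `(v, w)` is `⟨e_k, R^{T∂X}(v, w) e_j⟩`. -/
def curvatureForm (g : SmoothMetric n X) (y : Boundary n X)
    (e : Module.Basis (Fin n) ℝ (TangentSpace (𝓡 n) y)) (k j : Fin n) :
    ExteriorAlgebra ℝ (Module.Dual ℝ (TangentSpace (𝓡 n) y)) :=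
  (1 / 2 : ℝ) • ∑ a, ∑ b,
    boundaryMetric g y (e k) (curvature (boundaryMetric g) y (e a) (e b) (e j)) •
      (coframe e a * coframe e b)

/-- `Ṙ^{T∂X} = 1/2 ∑_{k,j} ⟨e_k, R^{T∂X} e_j⟩ ê^k ∧ ê^j`. -/
def dotR (g : SmoothMetric n X) (y : Boundary n X)
    (e : Module.Basis (Fin n) ℝ (TangentSpace (𝓡 n) y)) :
    DoubleExterior (Module.Dual ℝ (TangentSpace (𝓡 n) y)) :=
  (1 / 2 : ℝ) • ∑ k, ∑ j, hatMul (curvatureForm g y e k j) (coframe e k * coframe e j)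

/-- `Ṡ = 1/2 j^* ∇^{TX} ê_m^*`. The covector `∇_v e_m^*` vanishes on `e_m`, because `e_m^*` has
length one, so it is a combination of the covectors `e^b` of the boundary. -/
def dotS (g : SmoothMetric n X) (y : Boundary n X)
    (e : Module.Basis (Fin n) ℝ (TangentSpace (𝓡 n) y)) :
    DoubleExterior (Module.Dual ℝ (TangentSpace (𝓡 n) y)) :=
  (1 / 2 : ℝ) • ∑ a, ∑ b, normalDeriv g y (e a) (e b) • hatMul (coframe e a) (coframe e b)

/-- The value at `y` of the secondary form, computed in the orthonormal basis `e`. The sum is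
finite, since `Ṡ` is nilpotent. -/
def secondaryFormIn (o : ManifoldOrientation n X) (g : SmoothMetric n X) (y : Boundary n X)
    (e : Module.Basis (Fin n) ℝ (TangentSpace (𝓡 n) y)) :
    ExteriorAlgebra ℝ (Module.Dual ℝ (TangentSpace (𝓡 n) y)) :=
  berezin e (frameSign o g y e)
    (nilExp (-((1 / 2 : ℝ) • dotR g y e)) *
      ∑ᶠ (k : ℕ) (_ : 1 ≤ k), ((4 * (k : ℝ) * Real.Gamma (k + 1))⁻¹) • (-(dotS g y e ^ 2)) ^ k)

/-- The Brüning–Ma secondary form `B(∇^{TX})`, a differential form on the boundary. Its value at a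
point is computed in an orthonormal basis there, and does not depend on that basis. -/
def secondaryForm (o : ManifoldOrientation n X) (g : SmoothMetric n X) (y : Boundary n X) :
    ExteriorAlgebra ℝ (Module.Dual ℝ (TangentSpace (𝓡 n) y)) :=
  secondaryFormIn o g y (exists_orthonormalFrame g y).choose

end SecondaryClass

end BoundaryAnomaly

end

/-! Replacing `g₁` by `g₂ = s g₁` with `s` constant leaves the Levi-Civita connection, hence the
curvature operator, unchanged. Lowering an index multiplies the curvature term by `s`, so Ṙ becomes
s Ṙ (`dotR_smul`); the unit conormal is multiplied by √s, so Ṡ becomes √s Ṡ (`dotS_smul`). Ṙ carries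
two hatted covectors and Ṡ one, so both changes are effected by a single algebra endomorphism,
`hatScale` with t = √s, and the integrand for `g₂` is the image of the integrand for `g₁`.

The Berezin integral undoes this. Reading off the hatted part of degree n produces the factor
(√s)^n, while the determinant between a `g₁`-orthonormal and a `g₂`-orthonormal frame is (√s)^(-n)
in absolute value, its sign being absorbed by the orientation (`frameSign_changeBasis`). The factors
cancel in `berezin_hatScale_changeBasis`.

The frames chosen for the two metrics are unrelated, so Ṙ and Ṡ must also be shown independent of
the basis (`dotR_eq_of_basis`, `dotS_eq_of_basis`). -/

noncomputable section

namespace BoundaryAnomaly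

/-! ### Scaling of the hatted factor, and the Berezin integral. -/

section Berezin

variable {n : ℕ} {V : Type*} [AddCommGroup V] [Module ℝ V]

lemma map_mem_exteriorPower (f : V →ₗ[ℝ] V) {i : ℕ} {x : ExteriorAlgebra ℝ V}
    (hx : x ∈ ⋀[ℝ]^i V) : ExteriorAlgebra.map f x ∈ ⋀[ℝ]^i V := by
  have h : Submodule.map (ExteriorAlgebra.map f).toLinearMap (⋀[ℝ]^i V) ≤ ⋀[ℝ]^i V := by
    rw [Submodule.map_pow]
    refine pow_le_pow_left' ?_ i
    rintro _ ⟨_, ⟨v, rfl⟩, rfl⟩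
    exact ⟨f v, by simp⟩
  exact h ⟨x, hx, rfl⟩

/-- The endomorphism of `Λ V ⊗̂ Λ V` that multiplies the hatted vectors by `t`. -/
def hatScale (V : Type*) [AddCommGroup V] [Module ℝ V] (t : ℝ) :
    DoubleExterior V →ₐ[ℝ] DoubleExterior V :=
  GradedTensorProduct.lift (fun i : ℕ => ⋀[ℝ]^i V) (fun i : ℕ => ⋀[ℝ]^i V)
    (GradedTensorProduct.includeLeft _ _)
    ((GradedTensorProduct.includeRight _ _).comp
      (ExteriorAlgebra.map (t • (LinearMap.id : V →ₗ[ℝ] V))))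
    (fun i j a b => by
      -- Scaling preserves degree, so the image of `b` commutes with `a` up to the same Koszul sign
      -- as `b` does, and that sign squares to one.
      have hb := map_mem_exteriorPower (t • (LinearMap.id : V →ₗ[ℝ] V)) b.2
      have h := GradedTensorProduct.tmul_coe_mul_coe_tmul (R := ℝ) (fun i : ℕ => ⋀[ℝ]^i V)
        (fun i : ℕ => ⋀[ℝ]^i V) 1 ⟨_, hb⟩ a 1
      simp only [AlgHom.comp_apply, GradedTensorProduct.includeLeft_apply,
        GradedTensorProduct.includeRight_apply]
      rw [GradedTensorProduct.tmul_one_mul_one_tmul, h, smul_smul, Int.units_mul_self, one_smul,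
        one_mul, mul_one])

lemma hatScale_hatMul (t : ℝ) (α β : ExteriorAlgebra ℝ V) :
    hatScale V t (hatMul α β) =
      hatMul α (ExteriorAlgebra.map (t • (LinearMap.id : V →ₗ[ℝ] V)) β) := by
  unfold hatScale hatMul
  rw [GradedTensorProduct.lift_tmul]
  exact GradedTensorProduct.tmul_one_mul_one_tmul _ _ _ _

lemma doubleExterior_linearMap_ext {W : Type*} [AddCommGroup W] [Module ℝ W]
    {f g : DoubleExterior V →ₗ[ℝ] W} (h : ∀ α β, f (hatMul α β) = g (hatMul α β)) : f = g :=
  GradedTensorProduct.hom_ext _ _ (TensorProduct.ext' h)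

lemma hatScale_leftInverse {t : ℝ} (ht : t ≠ 0) :
    Function.LeftInverse (hatScale V t⁻¹) (hatScale V t) := by
  have h : (hatScale V t⁻¹).toLinearMap ∘ₗ (hatScale V t).toLinearMap = LinearMap.id := by
    refine doubleExterior_linearMap_ext fun α β => ?_
    have h1 : (ExteriorAlgebra.map (t⁻¹ • (LinearMap.id : V →ₗ[ℝ] V))).comp
        (ExteriorAlgebra.map (t • (LinearMap.id : V →ₗ[ℝ] V))) = AlgHom.id ℝ _ := by
      rw [ExteriorAlgebra.map_comp_map, ← ExteriorAlgebra.map_id]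
      congr 1
      ext v
      simp [smul_smul, inv_mul_cancel₀ ht]
    have h2 := DFunLike.congr_fun h1 β
    simp only [AlgHom.comp_apply, AlgHom.id_apply] at h2
    simp [hatScale_hatMul, h2]
  exact fun x => DFunLike.congr_fun h x

lemma hatScale_injective {t : ℝ} (ht : t ≠ 0) : Function.Injective (hatScale V t) :=
  (hatScale_leftInverse ht).injective

/-- Injectivity makes the two supports equal, so both sides take the default value 0 together if the
support is infinite. Thus the nilpotency that makes the series finite never has to be proved. The
index is a `Sort`, so that this also covers the inner sum over the proof of `1 ≤ k`. -/
lemma hatScale_finsum {ι : Sort*} {t : ℝ} (ht : t ≠ 0) (f : ι → DoubleExterior V) :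
    hatScale V t (∑ᶠ i, f i) = ∑ᶠ i, hatScale V t (f i) :=
  (hatScale V t).toLinearMap.toAddMonoidHom.map_finsum_of_injective (hatScale_injective ht) f

lemma hatScale_nilExp {t : ℝ} (ht : t ≠ 0) (a : DoubleExterior V) :
    hatScale V t (nilExp a) = nilExp (hatScale V t a) := by
  unfold nilExp
  simp only [hatScale_finsum ht, map_smul, map_pow]

lemma hatScale_nilExp_mul_finsum {t : ℝ} (ht : t ≠ 0)
    (c : ℝ) (a : ℕ → ℝ) (R S : DoubleExterior V) :
    hatScale V t (nilExp (-(c • R)) * ∑ᶠ (k : ℕ) (_ : 1 ≤ k), a k • (-(S ^ 2)) ^ k) =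
      nilExp (-(c • hatScale V t R)) *
        ∑ᶠ (k : ℕ) (_ : 1 ≤ k), a k • (-(hatScale V t S ^ 2)) ^ k := by
  simp only [map_mul, hatScale_nilExp ht, hatScale_finsum ht, map_smul, map_pow, map_neg]

lemma topEval_ιMulti_self (e : Module.Basis (Fin n) ℝ V) (f : Fin n → Module.Dual ℝ V) :
    topEval e (ExteriorAlgebra.ιMulti ℝ n f) = (Matrix.of fun i j => f i (e j)).det := by
  unfold topEval
  rw [ExteriorAlgebra.liftAlternating_apply_ιMulti]
  simp only [dite_true]
  rfl

lemma topEval_ιMulti_of_ne (e : Module.Basis (Fin n) ℝ V) {i : ℕ} (h : n ≠ i)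
    (f : Fin i → Module.Dual ℝ V) : topEval e (ExteriorAlgebra.ιMulti ℝ i f) = 0 := by
  unfold topEval
  rw [ExteriorAlgebra.liftAlternating_apply_ιMulti]
  simp [h]

lemma topEval_map_smul (e : Module.Basis (Fin n) ℝ V) (t : ℝ)
    (β : ExteriorAlgebra ℝ (Module.Dual ℝ V)) :
    topEval e (ExteriorAlgebra.map (t • (LinearMap.id : Module.Dual ℝ V →ₗ[ℝ] _)) β) =
      t ^ n * topEval e β := by
  suffices h : topEval e ∘ₗ (ExteriorAlgebra.map
      (t • (LinearMap.id : Module.Dual ℝ V →ₗ[ℝ] _))).toLinearMap = t ^ n • topEval e from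
    DFunLike.congr_fun h β
  refine ExteriorAlgebra.lhom_ext fun i => AlternatingMap.ext fun f => ?_
  simp only [LinearMap.compAlternatingMap_apply, LinearMap.comp_apply, AlgHom.toLinearMap_apply,
    ExteriorAlgebra.map_apply_ιMulti, LinearMap.smul_apply]
  obtain rfl | h := eq_or_ne n i
  · rw [topEval_ιMulti_self, topEval_ιMulti_self]
    have : (Matrix.of fun i j => ((t • (LinearMap.id : Module.Dual ℝ V →ₗ[ℝ] _)) ∘ f) i (e j)) =
        t • Matrix.of fun i j => f i (e j) := by
      ext; simp
    rw [this, Matrix.det_smul, Fintype.card_fin, smul_eq_mul]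
  · simp [topEval_ιMulti_of_ne e h]

lemma topEval_changeBasis (e e' : Module.Basis (Fin n) ℝ V)
    (β : ExteriorAlgebra ℝ (Module.Dual ℝ V)) :
    topEval e' β = (e.toMatrix e').det * topEval e β := by
  suffices h : topEval e' = (e.toMatrix e').det • topEval e from DFunLike.congr_fun h β
  refine ExteriorAlgebra.lhom_ext fun i => AlternatingMap.ext fun f => ?_
  simp only [LinearMap.compAlternatingMap_apply, LinearMap.smul_apply]
  obtain rfl | h := eq_or_ne n i
  · rw [topEval_ιMulti_self, topEval_ιMulti_self]
    have : (Matrix.of fun i j => f i (e' j)) =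
        (Matrix.of fun i j => f i (e j)) * e.toMatrix e' := by
      ext i j
      have h := congrArg (f i) (e.sum_toMatrix_smul_self e' j)
      rw [map_sum] at h
      simp [← h, Matrix.mul_apply, mul_comm]
    rw [this, Matrix.det_mul, smul_eq_mul, mul_comm]
  · simp [topEval_ιMulti_of_ne _ h]

lemma berezin_hatMul (e : Module.Basis (Fin n) ℝ V) (ε : ℝ)
    (α β : ExteriorAlgebra ℝ (Module.Dual ℝ V)) :
    berezin e ε (hatMul α β) =
      ((-1) ^ (n * (n + 1) / 2) * Real.pi ^ (-(n : ℝ) / 2) * ε) • topEval e β • α := by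
  simp [berezin, hatMul]

lemma berezin_hatScale (e : Module.Basis (Fin n) ℝ V) (ε t : ℝ)
    (x : DoubleExterior (Module.Dual ℝ V)) :
    berezin e ε (hatScale _ t x) = t ^ n • berezin e ε x := by
  suffices h : berezin e ε ∘ₗ (hatScale _ t).toLinearMap = t ^ n • berezin e ε from
    DFunLike.congr_fun h x
  refine doubleExterior_linearMap_ext fun α β => ?_
  simp only [LinearMap.comp_apply, AlgHom.toLinearMap_apply, hatScale_hatMul, berezin_hatMul,
    topEval_map_smul, LinearMap.smul_apply, smul_smul]
  congr 1
  ring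

/-- Only the product of the sign and the determinant matters, so orthonormality and orientation
enter later, through the single scalar `c`. -/
lemma berezin_changeBasis (e e' : Module.Basis (Fin n) ℝ V) {ε ε' c : ℝ}
    (h : ε' * (e.toMatrix e').det = c * ε) (x : DoubleExterior (Module.Dual ℝ V)) :
    berezin e' ε' x = c • berezin e ε x := by
  suffices h : berezin e' ε' = c • berezin e ε from DFunLike.congr_fun h x
  refine doubleExterior_linearMap_ext fun α β => ?_
  simp only [berezin_hatMul, LinearMap.smul_apply, smul_smul, topEval_changeBasis e e']
  congr 1
  linear_combination ((-1) ^ (n * (n + 1) / 2) * Real.pi ^ (-(n : ℝ) / 2) * topEval e β) * h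

/-- The `n` hatted covectors contribute `t ^ n`, which the change of basis cancels. -/
lemma berezin_hatScale_changeBasis (e e' : Module.Basis (Fin n) ℝ V) {ε ε' t : ℝ} (ht : t ≠ 0)
    (h : ε' * (e.toMatrix e').det = t⁻¹ ^ n * ε) (x : DoubleExterior (Module.Dual ℝ V)) :
    berezin e' ε' (hatScale _ t x) = berezin e ε x := by
  rw [berezin_changeBasis e e' h, berezin_hatScale, smul_smul, ← mul_pow, inv_mul_cancel₀ ht,
    one_pow, one_smul]

end Berezin

/-! ### Basis independence of contractions. -/

section Contraction

variable {n : ℕ} {V A B W : Type*} [AddCommGroup V] [Module ℝ V] [AddCommGroup A] [Module ℝ A]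
  [AddCommGroup B] [Module ℝ B] [AddCommGroup W] [Module ℝ W]

/-- The sum is the image of the canonical element ∑ e_a ⊗ e^a of V ⊗ V*, which corresponds to the
identity of V. -/
lemma sum_apply_coord_eq (e e' : Module.Basis (Fin n) ℝ V)
    (F : V →ₗ[ℝ] Module.Dual ℝ V →ₗ[ℝ] W) :
    ∑ a, F (e a) (e.coord a) = ∑ a, F (e' a) (e'.coord a) := by
  have h1 : ∀ b, F (e' b) (e'.coord b) = ∑ a, F (e a) (e.coord a (e' b) • e'.coord b) := fun b => by
    have h := congrArg (fun v => F v (e'.coord b)) (e.sum_repr (e' b))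
    simp only [map_sum, map_smul, LinearMap.sum_apply, LinearMap.smul_apply] at h
    simp only [map_smul, Module.Basis.coord_apply, h]
  have h2 : ∀ a, ∑ b, e.coord a (e' b) • e'.coord b = e.coord a := fun a => by
    refine e'.ext fun b => ?_
    simp [Finsupp.single_apply]
  simp_rw [h1]
  rw [Finset.sum_comm]
  simp_rw [← map_sum, h2]

/-- The full contraction of a bilinear map on `V` with a bilinear map on the dual of `V` does not
depend on the basis. -/
lemma sum_sum_apply_coord_eq (e e' : Module.Basis (Fin n) ℝ V) (N : V →ₗ[ℝ] V →ₗ[ℝ] A)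
    (P : Module.Dual ℝ V →ₗ[ℝ] Module.Dual ℝ V →ₗ[ℝ] B) (Q : A →ₗ[ℝ] B →ₗ[ℝ] W) :
    ∑ a, ∑ b, Q (N (e a) (e b)) (P (e.coord a) (e.coord b)) =
      ∑ a, ∑ b, Q (N (e' a) (e' b)) (P (e'.coord a) (e'.coord b)) := by
  have h1 : ∀ (x : V) (φ : Module.Dual ℝ V), ∑ b, Q (N x (e b)) (P φ (e.coord b)) =
      ∑ b, Q (N x (e' b)) (P φ (e'.coord b)) := fun x φ =>
    sum_apply_coord_eq e e' (Q.compl₁₂ (N x) (P φ))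
  simp_rw [h1]
  rw [Finset.sum_comm]
  conv_rhs => rw [Finset.sum_comm]
  exact Finset.sum_congr rfl fun b _ =>
    sum_apply_coord_eq e e' (Q.compl₁₂ (N.flip (e' b)) (P.flip (e'.coord b)))

end Contraction

/-! ### Connection and curvature under a constant rescaling. -/

section LeviCivita

variable {d : ℕ} {H : Type*} [TopologicalSpace H] {M : Type*} [TopologicalSpace M]
  [ChartedSpace H M] {I : ModelWithCorners ℝ (Coord d) H}

lemma coordDeriv_const_mul (i : Fin d) (c : ℝ) (f : Coord d → ℝ) (u : Coord d) :
    coordDeriv I i (fun z => c * f z) u = c * coordDeriv I i f u := by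
  unfold coordDeriv
  by_cases hu : u ∈ Set.range I
  · have h := fderivWithin_const_smul_field (𝕜 := ℝ) (f := f) c (I.uniqueDiffOn u hu)
    exact DFunLike.congr_fun h _
  -- Off the closed range of `I`, `fderivWithin` is zero for both functions.
  · have hu' : u ∉ closure (Set.range I) := by rwa [I.isClosed_range.closure_eq]
    simp [fderivWithin_zero_of_notMem_closure hu']

lemma metricCoeff_smul {g g' : BilinField I M} {s : ℝ} (h : ∀ x v w, g' x v w = s * g x v w)
    (p : M) (u : Coord d) : metricCoeff g' p u = s • metricCoeff g p u := by
  ext i j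
  exact h _ _ _

/-- Singular matrices are included because the coordinate point `u` is arbitrary and may lie outside
the chart; both inverses are then the default 0. -/
lemma inv_smul_matrix {ι : Type*} [Fintype ι] [DecidableEq ι] {s : ℝ} (hs : s ≠ 0)
    (A : Matrix ι ι ℝ) : (s • A)⁻¹ = s⁻¹ • A⁻¹ := by
  by_cases hA : IsUnit A.det
  · exact A.inv_smul' (Units.mk0 s hs) hA
  · rw [Matrix.nonsing_inv_apply_not_isUnit A hA, smul_zero]
    refine Matrix.nonsing_inv_apply_not_isUnit _ fun h => hA ?_
    rw [Matrix.det_smul] at h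
    exact isUnit_of_mul_isUnit_right h

/-- The factor `s` from the derivatives cancels `s⁻¹` from the inverse matrix. The equality is one
of functions of `u`, so it can be differentiated to compare curvatures. -/
lemma christoffel_congr_of_smul {g g' : BilinField I M} {s : ℝ} (hs : s ≠ 0)
    (h : ∀ x v w, g' x v w = s * g x v w) (p : M) : christoffel g' p = christoffel g p := by
  funext k i j u
  unfold christoffel
  simp only [metricCoeff_smul h p, inv_smul_matrix hs, Matrix.smul_apply, smul_eq_mul,
    coordDeriv_const_mul]
  congr 1
  refine Finset.sum_congr rfl fun l _ => ?_
  field_simp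

lemma curvature_congr_of_smul {g g' : BilinField I M} {s : ℝ} (hs : s ≠ 0)
    (h : ∀ x v w, g' x v w = s * g x v w) (p : M) : curvature g' p = curvature g p := by
  funext v w z
  unfold curvature curvatureCoeff
  rw [christoffel_congr_of_smul hs h]

lemma tangentCoord_add (p : M) (v w : TangentSpace I p) (i : Fin d) :
    tangentCoord p (v + w) i = tangentCoord p v i + tangentCoord p w i := rfl

lemma tangentCoord_smul (p : M) (c : ℝ) (v : TangentSpace I p) (i : Fin d) :
    tangentCoord p (c • v) i = c * tangentCoord p v i := rfl

lemma tangentVec_add (p : M) (c c' : Fin d → ℝ) :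
    (tangentVec p (c + c') : TangentSpace I p) = tangentVec p c + tangentVec p c' := rfl

lemma tangentVec_smul (p : M) (r : ℝ) (c : Fin d → ℝ) :
    (tangentVec p (r • c) : TangentSpace I p) = r • tangentVec p c := rfl

/-- The curvature operator as a trilinear map. -/
def curvatureLin (g : BilinField I M) (p : M) :
    TangentSpace I p →ₗ[ℝ] TangentSpace I p →ₗ[ℝ] TangentSpace I p →ₗ[ℝ] TangentSpace I p :=
  LinearMap.mk₂ ℝ
    (fun v w =>
      { toFun := curvature g p v w
        map_add' := fun z z' => by
          unfold curvature
          rw [← tangentVec_add]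
          congr 1
          funext l
          simp only [tangentCoord_add, mul_add, add_mul, Finset.sum_add_distrib, Pi.add_apply]
        map_smul' := fun c z => by
          unfold curvature
          rw [RingHom.id_apply, ← tangentVec_smul]
          congr 1
          funext l
          simp only [tangentCoord_smul, Pi.smul_apply, smul_eq_mul, Finset.mul_sum]
          refine Finset.sum_congr rfl fun _ _ => Finset.sum_congr rfl fun _ _ =>
            Finset.sum_congr rfl fun _ _ => ?_
          ring })
    (fun v v' w => LinearMap.ext fun z => by
      change curvature g p (v + v') w z = curvature g p v w z + curvature g p v' w z
      unfold curvature
      rw [← tangentVec_add]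
      congr 1
      funext l
      simp only [tangentCoord_add, add_mul, Finset.sum_add_distrib, Pi.add_apply])
    (fun c v w => LinearMap.ext fun z => by
      change curvature g p (c • v) w z = c • curvature g p v w z
      unfold curvature
      rw [← tangentVec_smul]
      congr 1
      funext l
      simp only [tangentCoord_smul, Pi.smul_apply, smul_eq_mul, Finset.mul_sum, mul_assoc])
    (fun v w w' => LinearMap.ext fun z => by
      change curvature g p v (w + w') z = curvature g p v w z + curvature g p v w' z
      unfold curvature
      rw [← tangentVec_add]
      congr 1
      funext l
      simp only [tangentCoord_add, mul_add, add_mul, Finset.sum_add_distrib, Pi.add_apply])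
    (fun c v w => LinearMap.ext fun z => by
      change curvature g p v (c • w) z = c • curvature g p v w z
      unfold curvature
      rw [← tangentVec_smul]
      congr 1
      funext l
      simp only [tangentCoord_smul, Pi.smul_apply, smul_eq_mul, Finset.mul_sum]
      refine Finset.sum_congr rfl fun _ _ => Finset.sum_congr rfl fun _ _ =>
        Finset.sum_congr rfl fun _ _ => ?_
      ring)

end LeviCivita

/-! ### Basis independence of Ṙ and Ṡ. -/

section Boundary

variable {n : ℕ} {X : Type*} [TopologicalSpace X] [ChartedSpace (EuclideanHalfSpace (n + 1)) X]
  [IsManifold (𝓡∂ (n + 1)) ∞ X]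

/-- The second fundamental form `(v, w) ↦ (∇_v e_m^*)(w)` as a bilinear map. -/
def normalDerivLin (g : SmoothMetric n X) (y : Boundary n X) :
    TangentSpace (𝓡 n) y →ₗ[ℝ] TangentSpace (𝓡 n) y →ₗ[ℝ] ℝ :=
  LinearMap.mk₂ ℝ (normalDeriv g y)
    (fun v v' w => by
      simp only [normalDeriv, map_add, tangentCoord_add, add_mul, Finset.sum_add_distrib])
    (fun c v w => by
      simp only [normalDeriv, map_smul, tangentCoord_smul, smul_eq_mul, Finset.mul_sum, mul_assoc])
    (fun v w w' => by
      simp only [normalDeriv, map_add, tangentCoord_add, mul_add, add_mul, Finset.sum_add_distrib])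
    (fun c v w => by
      simp only [normalDeriv, map_smul, tangentCoord_smul, smul_eq_mul, Finset.mul_sum]
      refine Finset.sum_congr rfl fun _ _ => Finset.sum_congr rfl fun _ _ => ?_
      ring)

/-- The product of two covectors as a bilinear map into the exterior algebra. -/
def wedge (V : Type*) [AddCommGroup V] [Module ℝ V] : V →ₗ[ℝ] V →ₗ[ℝ] ExteriorAlgebra ℝ V :=
  (LinearMap.mul ℝ (ExteriorAlgebra ℝ V)).compl₁₂ (ExteriorAlgebra.ι ℝ) (ExteriorAlgebra.ι ℝ)

/-- The map `(α, β) ↦ α β̂` as a bilinear map. -/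
def hatMulLin (V : Type*) [AddCommGroup V] [Module ℝ V] :
    ExteriorAlgebra ℝ V →ₗ[ℝ] ExteriorAlgebra ℝ V →ₗ[ℝ] DoubleExterior V :=
  (TensorProduct.mk ℝ (ExteriorAlgebra ℝ V) (ExteriorAlgebra ℝ V)).compr₂
    (GradedTensorProduct.of ℝ (fun i : ℕ => ⋀[ℝ]^i V) (fun i : ℕ => ⋀[ℝ]^i V)).toLinearMap

lemma hatMulLin_apply {V : Type*} [AddCommGroup V] [Module ℝ V] (α β : ExteriorAlgebra ℝ V) :
    hatMulLin V α β = hatMul α β := rfl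

/-- Each vector is paired with its own dual covector, so no orthonormality is needed. This permits
the use of one common basis for both metrics. -/
lemma dotS_eq_of_basis (g : SmoothMetric n X) (y : Boundary n X)
    (e e' : Module.Basis (Fin n) ℝ (TangentSpace (𝓡 n) y)) : dotS g y e = dotS g y e' := by
  have h := sum_sum_apply_coord_eq e e' (normalDerivLin g y)
    ((hatMulLin _).compl₁₂ (ExteriorAlgebra.ι ℝ) (ExteriorAlgebra.ι ℝ))
    (LinearMap.lsmul ℝ (DoubleExterior (Module.Dual ℝ (TangentSpace (𝓡 n) y))))
  exact congrArg ((1 / 2 : ℝ) • ·) h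

/-- The two-form `⟨x, R^{T∂X} z⟩` in the basis `e`, bilinear in `x` and `z`. -/
def curvatureFormLin (g : SmoothMetric n X) (y : Boundary n X)
    (e : Module.Basis (Fin n) ℝ (TangentSpace (𝓡 n) y)) :
    TangentSpace (𝓡 n) y →ₗ[ℝ] TangentSpace (𝓡 n) y →ₗ[ℝ]
      ExteriorAlgebra ℝ (Module.Dual ℝ (TangentSpace (𝓡 n) y)) :=
  LinearMap.mk₂ ℝ
    (fun x z => (1 / 2 : ℝ) • ∑ a, ∑ b,
      boundaryMetric g y x (curvatureLin (boundaryMetric g) y (e a) (e b) z) •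
        (coframe e a * coframe e b))
    (fun x x' z => by
      simp only [map_add, LinearMap.add_apply, add_smul, Finset.sum_add_distrib, smul_add])
    (fun c x z => by
      simp only [map_smul, LinearMap.smul_apply, smul_eq_mul, mul_smul, ← Finset.smul_sum]
      rw [smul_comm])
    (fun x z z' => by
      simp only [map_add, add_smul, Finset.sum_add_distrib, smul_add])
    (fun c x z => by
      simp only [map_smul, smul_eq_mul, mul_smul, ← Finset.smul_sum]
      rw [smul_comm])

lemma curvatureFormLin_eq_of_basis (g : SmoothMetric n X) (y : Boundary n X)
    (e e' : Module.Basis (Fin n) ℝ (TangentSpace (𝓡 n) y)) :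
    curvatureFormLin g y e = curvatureFormLin g y e' := by
  refine LinearMap.ext₂ fun x z => ?_
  have h := sum_sum_apply_coord_eq e e'
    ((curvatureLin (boundaryMetric g) y).compr₂
      (boundaryMetric g y x ∘ₗ LinearMap.applyₗ z))
    (wedge _) (LinearMap.lsmul ℝ (ExteriorAlgebra ℝ (Module.Dual ℝ (TangentSpace (𝓡 n) y))))
  exact congrArg ((1 / 2 : ℝ) • ·) h

/-- There are two nested contractions: the hatted indices k, j, and the indices a, b inside the
curvature two-form. -/
lemma dotR_eq_of_basis (g : SmoothMetric n X) (y : Boundary n X)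
    (e e' : Module.Basis (Fin n) ℝ (TangentSpace (𝓡 n) y)) : dotR g y e = dotR g y e' := by
  have h := sum_sum_apply_coord_eq e e' (curvatureFormLin g y e) (wedge _) (hatMulLin _)
  -- The outer contraction alone leaves the two-forms on the right expanded in `e`.
  conv_rhs at h => rw [curvatureFormLin_eq_of_basis g y e e']
  exact congrArg ((1 / 2 : ℝ) • ·) h

/-! ### Scaling weights of the normal, Ṡ and Ṙ. -/

section Scaling

variable {g₁ g₂ : SmoothMetric n X} {s : ℝ}

lemma metricForm_smul (hg : ∀ (x : X) (v w : TangentSpace (𝓡∂ (n + 1)) x),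
    g₂.inner x v w = s * g₁.inner x v w) (x : X) (v w : TangentSpace (𝓡∂ (n + 1)) x) :
    metricForm g₂ x v w = s * metricForm g₁ x v w := hg x v w

lemma boundaryMetric_smul (hg : ∀ (x : X) (v w : TangentSpace (𝓡∂ (n + 1)) x),
    g₂.inner x v w = s * g₁.inner x v w) (y : Boundary n X) (v w : TangentSpace (𝓡 n) y) :
    boundaryMetric g₂ y v w = s * boundaryMetric g₁ y v w := hg y.1 _ _

/-- The weight is s⁻¹ / √(s⁻¹) = (√s)⁻¹. -/
lemma unitNormalCoeff_smul (hs : 0 < s) (hg : ∀ (x : X) (v w : TangentSpace (𝓡∂ (n + 1)) x),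
    g₂.inner x v w = s * g₁.inner x v w) (p : X) (k : Fin (n + 1)) (u : Coord (n + 1)) :
    unitNormalCoeff g₂ p k u = (√s)⁻¹ * unitNormalCoeff g₁ p k u := by
  unfold unitNormalCoeff
  rw [metricCoeff_smul (metricForm_smul hg), inv_smul_matrix hs.ne']
  simp only [Matrix.smul_apply, smul_eq_mul]
  rw [Real.sqrt_mul (inv_nonneg.2 hs.le), Real.sqrt_inv, mul_div_mul_comm, div_inv_eq_mul]
  congr 1
  have h := Real.mul_self_sqrt hs.le
  have h' := (Real.sqrt_pos.2 hs).ne'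
  field_simp
  nlinarith

lemma unitNormal_smul (hs : 0 < s) (hg : ∀ (x : X) (v w : TangentSpace (𝓡∂ (n + 1)) x),
    g₂.inner x v w = s * g₁.inner x v w) (y : Boundary n X) :
    unitNormal g₂ y = (√s)⁻¹ • unitNormal g₁ y := by
  unfold unitNormal
  rw [← tangentVec_smul]
  congr 1
  funext k
  exact unitNormalCoeff_smul hs hg _ _ _

/-- The weight is s · (√s)⁻¹ = √s: lowering the index contributes `s`. -/
lemma unitConormalCoeff_smul (hs : 0 < s) (hg : ∀ (x : X) (v w : TangentSpace (𝓡∂ (n + 1)) x),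
    g₂.inner x v w = s * g₁.inner x v w) (p : X) (j : Fin (n + 1)) :
    unitConormalCoeff g₂ p j = fun u => √s * unitConormalCoeff g₁ p j u := by
  funext u
  unfold unitConormalCoeff
  rw [Finset.mul_sum]
  refine Finset.sum_congr rfl fun k _ => ?_
  rw [metricCoeff_smul (metricForm_smul hg), unitNormalCoeff_smul hs hg, Matrix.smul_apply,
    smul_eq_mul]
  nth_rewrite 1 [← Real.mul_self_sqrt hs.le]
  have h' := (Real.sqrt_pos.2 hs).ne'
  field_simp

lemma normalDeriv_smul (hs : 0 < s) (hg : ∀ (x : X) (v w : TangentSpace (𝓡∂ (n + 1)) x),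
    g₂.inner x v w = s * g₁.inner x v w) (y : Boundary n X) (v w : TangentSpace (𝓡 n) y) :
    normalDeriv g₂ y v w = √s * normalDeriv g₁ y v w := by
  unfold normalDeriv covDerivForm
  simp only [christoffel_congr_of_smul hs.ne' (metricForm_smul hg), unitConormalCoeff_smul hs hg,
    coordDeriv_const_mul, Finset.mul_sum]
  refine Finset.sum_congr rfl fun i _ => Finset.sum_congr rfl fun j _ => ?_
  simp only [mul_left_comm _ (√s), ← Finset.mul_sum, ← mul_sub]

lemma dotS_smul (hs : 0 < s) (hg : ∀ (x : X) (v w : TangentSpace (𝓡∂ (n + 1)) x),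
    g₂.inner x v w = s * g₁.inner x v w) (y : Boundary n X)
    (e : Module.Basis (Fin n) ℝ (TangentSpace (𝓡 n) y)) :
    dotS g₂ y e = √s • dotS g₁ y e := by
  unfold dotS
  simp only [normalDeriv_smul hs hg, mul_smul, ← Finset.smul_sum]
  rw [smul_comm]

lemma dotR_smul (hs : 0 < s) (hg : ∀ (x : X) (v w : TangentSpace (𝓡∂ (n + 1)) x),
    g₂.inner x v w = s * g₁.inner x v w) (y : Boundary n X)
    (e : Module.Basis (Fin n) ℝ (TangentSpace (𝓡 n) y)) :
    dotR g₂ y e = s • dotR g₁ y e := by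
  have h : ∀ k j, curvatureForm g₂ y e k j = s • curvatureForm g₁ y e k j := fun k j => by
    unfold curvatureForm
    simp only [curvature_congr_of_smul hs.ne' (boundaryMetric_smul hg), boundaryMetric_smul hg,
      mul_smul, ← Finset.smul_sum]
    rw [smul_comm]
  unfold dotR
  simp only [h, ← hatMulLin_apply, map_smul, LinearMap.smul_apply, ← Finset.smul_sum]
  rw [smul_comm]

end Scaling

end Boundary

/-! ### Boundary orientation and signs of frames. -/

/-- The matrix has first column (c, 0, …, 0) and the boundary change of basis as its remaining
block. This reduces comparing orientations of T_yX to a determinant on T_y∂X. -/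
lemma det_toMatrix_of_cons {n : ℕ} {V W : Type*} [AddCommGroup V] [Module ℝ V] [AddCommGroup W]
    [Module ℝ W] (J : V →ₗ[ℝ] W) (e e' : Module.Basis (Fin n) ℝ V)
    (b b' : Module.Basis (Fin (n + 1)) ℝ W) {c : ℝ} (h₀ : b' 0 = c • b 0)
    (hb : ∀ i, b i.succ = J (e i)) (hb' : ∀ i, b' i.succ = J (e' i)) :
    (b.toMatrix b').det = c * (e.toMatrix e').det := by
  have h1 : ∀ i, b.toMatrix b' i 0 = if i = 0 then c else 0 := fun i => by
    rw [Module.Basis.toMatrix_apply, h₀]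
    simp [Finsupp.single_apply, eq_comm]
  have h2 : ∀ i j, b.toMatrix b' (Fin.succ i) (Fin.succ j) = e.toMatrix e' i j := fun i j => by
    rw [Module.Basis.toMatrix_apply, hb', ← e.sum_toMatrix_smul_self e' j]
    simp only [map_sum, map_smul, ← hb, Module.Basis.repr_self, Finsupp.coe_finsetSum,
      Finset.sum_apply, Finsupp.smul_apply, Finsupp.single_apply, Fin.succ_inj]
    simp
  rw [Matrix.det_succ_column_zero, Fin.sum_univ_succ]
  have h3 : (b.toMatrix b').submatrix (Fin.succAbove 0) Fin.succ = e.toMatrix e' := by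
    ext i j
    simp [h2]
  rw [h3]
  simp [h1]

section Boundary

variable {n : ℕ} {X : Type*} [TopologicalSpace X] [ChartedSpace (EuclideanHalfSpace (n + 1)) X]
  [IsManifold (𝓡∂ (n + 1)) ∞ X]

/-- This is the Gram matrix of the metric in the images of the coordinate vectors under the
injective differential of the inverse chart. It is needed to see that the normal is transverse to
the boundary. -/
lemma metricCoeff_posDef (g : SmoothMetric n X) (p : X) :
    (metricCoeff (metricForm g) p (extChartAt (𝓡∂ (n + 1)) p p)).PosDef := by
  have : IsManifold (𝓡∂ (n + 1)) 1 X := IsManifold.of_le (n := ∞) (by simp)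
  set u := extChartAt (𝓡∂ (n + 1)) p p
  set D := mfderivWithin 𝓘(ℝ, Coord (n + 1)) (𝓡∂ (n + 1)) (extChartAt (𝓡∂ (n + 1)) p).symm
    (Set.range (𝓡∂ (n + 1))) u
  have hDinj : Function.Injective D :=
    (isInvertible_mfderivWithin_extChartAt_symm (mem_extChartAt_target p)).injective
  have hquad : ∀ x : Fin (n + 1) → ℝ,
      x ⬝ᵥ (metricCoeff (metricForm g) p u).mulVec x =
        g.inner _ (D (WithLp.toLp 2 x)) (D (WithLp.toLp 2 x)) := fun x => by
    have hx : (WithLp.toLp 2 x : Coord (n + 1)) =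
        ∑ i, x i • (EuclideanSpace.single i 1 : Coord (n + 1)) := by
      ext j
      simp [Finset.sum_apply, Pi.single_apply]
    have hDx : D (WithLp.toLp 2 x) = ∑ i, x i • D (EuclideanSpace.single i 1) := by
      rw [hx]
      exact (map_sum D _ _).trans (Finset.sum_congr rfl fun i _ => map_smul D _ _)
    rw [hDx]
    change _ = metricForm g _ _ _
    simp only [map_sum, map_smul, LinearMap.sum_apply, LinearMap.smul_apply, smul_eq_mul]
    simp only [dotProduct, Matrix.mulVec, Finset.mul_sum]
    rw [Finset.sum_comm]
    refine Finset.sum_congr rfl fun i _ => Finset.sum_congr rfl fun j _ => ?_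
    change x j * (metricForm g _ (D (EuclideanSpace.single j 1)) (D (EuclideanSpace.single i 1)) *
      x i) = _
    ring
  refine Matrix.PosDef.of_dotProduct_mulVec_pos ?_ fun x hx => ?_
  · ext i j
    exact g.symm _ _ _
  · rw [star_trivial, hquad]
    refine g.pos _ _ fun h => hx ?_
    have h' := hDinj (h.trans (map_zero D).symm)
    funext i
    exact congrArg (fun v : Coord (n + 1) => v i) h'

lemma tangentCoord_unitNormal_zero_pos (g : SmoothMetric n X) (y : Boundary n X) :
    0 < tangentCoord y.1 (unitNormal g y) 0 := by
  change 0 < unitNormalCoeff g y.1 0 (extChartAt (𝓡∂ (n + 1)) y.1 y.1)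
  have h := (metricCoeff_posDef g y.1).inv.diag_pos (i := 0)
  exact div_pos h (Real.sqrt_pos.2 h)

lemma tangentCoord_boundaryInclusion_zero (y : Boundary n X) (v : TangentSpace (𝓡 n) y) :
    tangentCoord y.1 (boundaryInclusion y v) 0 = 0 := by
  unfold boundaryInclusion
  rw [(hasMFDerivAt_boundary_val y).mfderiv]
  rfl

/-- A basis of the boundary, extended by the outward normal vector. -/
lemma exists_outwardFrame (g : SmoothMetric n X) (y : Boundary n X)
    (e : Module.Basis (Fin n) ℝ (TangentSpace (𝓡 n) y)) :
    ∃ b : Module.Basis (Fin (n + 1)) ℝ (TangentSpace (𝓡∂ (n + 1)) y.1),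
      b 0 = -unitNormal g y ∧ ∀ i, b i.succ = boundaryInclusion y (e i) := by
  let W := TangentSpace (𝓡∂ (n + 1)) y.1
  have : FiniteDimensional ℝ W := inferInstanceAs (FiniteDimensional ℝ (Coord (n + 1)))
  have hdim : Module.finrank ℝ W = n + 1 := finrank_euclideanSpace_fin (𝕜 := ℝ) (n := n + 1)
  let f : Fin (n + 1) → W := Fin.cons (-unitNormal g y) fun i => boundaryInclusion y (e i)
  -- The covector dx_0 vanishes on boundary vectors but not on the normal, which therefore lies
  -- outside their span.
  let ξ : W →ₗ[ℝ] ℝ :=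
    { toFun := fun w => tangentCoord y.1 w 0
      map_add' := fun v w => tangentCoord_add y.1 v w 0
      map_smul' := fun c v => tangentCoord_smul y.1 c v 0 }
  have hf : LinearIndependent ℝ f := by
    refine linearIndependent_finCons.2 ⟨?_, fun h => ?_⟩
    · exact e.linearIndependent.map' (boundaryInclusion y).toLinearMap
        (LinearMap.ker_eq_bot.2 (boundaryInclusion_injective y))
    · have hle : Submodule.span ℝ (Set.range fun i => boundaryInclusion y (e i)) ≤
          LinearMap.ker ξ := by
        rw [Submodule.span_le]
        rintro _ ⟨i, rfl⟩
        exact tangentCoord_boundaryInclusion_zero y (e i)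
      have h0 : ξ (-unitNormal g y) = 0 := hle h
      rw [map_neg, neg_eq_zero] at h0
      exact (tangentCoord_unitNormal_zero_pos g y).ne' h0
  let b := basisOfLinearIndependentOfCardEqFinrank hf (by simp [hdim])
  have hb : ⇑b = f := coe_basisOfLinearIndependentOfCardEqFinrank hf _
  exact ⟨b, by rw [hb]; rfl, fun i => by rw [hb]; rfl⟩

open Classical in
-- A basis with the prescribed values is unique, so the existential in `frameSign` can be tested on
-- any one such basis.
lemma frameSign_eq_ite (o : ManifoldOrientation n X) (g : SmoothMetric n X) (y : Boundary n X)
    (e : Module.Basis (Fin n) ℝ (TangentSpace (𝓡 n) y))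
    (b : Module.Basis (Fin (n + 1)) ℝ (TangentSpace (𝓡∂ (n + 1)) y.1))
    (h₀ : b 0 = -unitNormal g y) (hb : ∀ i, b i.succ = boundaryInclusion y (e i)) :
    frameSign o g y e = if b.orientation = o.orient y.1 then 1 else -1 := by
  unfold frameSign
  congr 1
  refine propext ⟨?_, fun h => ⟨b, h₀, hb, h⟩⟩
  rintro ⟨b', h₀', hb', h⟩
  have : b' = b := Module.Basis.eq_of_apply_eq <| Fin.cases (h₀'.trans h₀.symm) fun i =>
    (hb' i).trans (hb i).symm
  rwa [← this]

/-- The two normals are positively proportional, so the extended frames have the same orientation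
exactly when the boundary determinant is positive. -/
lemma frameSign_changeBasis (o : ManifoldOrientation n X) {g₁ g₂ : SmoothMetric n X}
    {y : Boundary n X} {c : ℝ} (hc : 0 < c) (hν : unitNormal g₂ y = c • unitNormal g₁ y)
    (e e' : Module.Basis (Fin n) ℝ (TangentSpace (𝓡 n) y)) :
    frameSign o g₂ y e' * (e.toMatrix e').det = |(e.toMatrix e').det| * frameSign o g₁ y e := by
  obtain ⟨b, h₀, hb⟩ := exists_outwardFrame g₁ y e
  obtain ⟨b', h₀', hb'⟩ := exists_outwardFrame g₂ y e'
  rw [frameSign_eq_ite o g₁ y e b h₀ hb, frameSign_eq_ite o g₂ y e' b' h₀' hb']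
  have hdet : (b.toMatrix b').det = c * (e.toMatrix e').det :=
    det_toMatrix_of_cons (boundaryInclusion y).toLinearMap e e' b b'
      (by rw [h₀', h₀, hν, smul_neg]) hb hb'
  have hiff : b.orientation = b'.orientation ↔ 0 < (e.toMatrix e').det := by
    rw [b.orientation_eq_iff_det_pos b', Module.Basis.det_apply, hdet, mul_pos_iff_of_pos_left hc]
  have hne : (e.toMatrix e').det ≠ 0 := by
    rw [← Module.Basis.det_apply]
    exact (e.isUnit_det e').ne_zero
  obtain hpos | hneg := hne.symm.lt_or_gt
  · rw [hiff.2 hpos, abs_of_pos hpos, mul_comm]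
  · have h1 : b'.orientation ≠ b.orientation := fun h => (hiff.1 h.symm).not_gt hneg
    have h2 := (b.orientation_ne_iff_eq_neg b'.orientation).1 h1
    -- There are only two orientations, so exactly one of the two opposite frames agrees with `o`.
    have h3 : b'.orientation = o.orient y.1 ↔ ¬ b.orientation = o.orient y.1 := by
      rw [← ne_eq, ne_comm, b.orientation_ne_iff_eq_neg, h2, eq_comm]
    rw [abs_of_neg hneg]
    by_cases h : b.orientation = o.orient y.1
    · rw [if_pos h, if_neg (fun h' => h3.1 h' h)]
      ring
    · rw [if_neg h, if_pos (h3.2 h)]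
      ring

/-! ### Comparison of the two integrals. -/

section Scaling

variable {g₁ g₂ : SmoothMetric n X} {s : ℝ}

/-- In a `g₁`-orthonormal basis the Gram matrix of `e'` for `g₁` is MᵀM, and it equals s⁻¹ times the
identity; hence (det M)² = s⁻ⁿ. -/
lemma abs_det_toMatrix_orthonormal (hs : 0 < s)
    (hg : ∀ (x : X) (v w : TangentSpace (𝓡∂ (n + 1)) x),
      g₂.inner x v w = s * g₁.inner x v w) {y : Boundary n X}
    {e e' : Module.Basis (Fin n) ℝ (TangentSpace (𝓡 n) y)} (he : IsOrthonormalFrame g₁ y e)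
    (he' : IsOrthonormalFrame g₂ y e') : |(e.toMatrix e').det| = (√s)⁻¹ ^ n := by
  have hgram : (e.toMatrix e').transpose * e.toMatrix e' = s⁻¹ • (1 : Matrix (Fin n) (Fin n) ℝ) := by
    ext i j
    have h1 : boundaryMetric g₁ y (e' i) (e' j) =
        ((e.toMatrix e').transpose * e.toMatrix e') i j := by
      rw [← e.sum_toMatrix_smul_self e' i, ← e.sum_toMatrix_smul_self e' j]
      simp only [map_sum, map_smul, LinearMap.sum_apply, LinearMap.smul_apply, smul_eq_mul,
        he _ _, Matrix.mul_apply, Matrix.transpose_apply]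
      simp [mul_comm]
    have h2 := he' i j
    rw [boundaryMetric_smul hg, h1] at h2
    rw [Matrix.smul_apply, Matrix.one_apply, ← h2, smul_eq_mul, inv_mul_cancel_left₀ hs.ne']
  have h := congrArg Matrix.det hgram
  rw [Matrix.det_mul, Matrix.det_transpose, Matrix.det_smul, Matrix.det_one, mul_one,
    Fintype.card_fin] at h
  rw [← abs_of_nonneg (pow_nonneg (inv_nonneg.2 (Real.sqrt_nonneg s)) n), ← sq_eq_sq_iff_abs_eq_abs,
    sq, h, ← pow_mul, mul_comm, pow_mul, inv_pow (√s) 2, Real.sq_sqrt hs.le]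

lemma hatScale_dotS (g : SmoothMetric n X) (y : Boundary n X)
    (e : Module.Basis (Fin n) ℝ (TangentSpace (𝓡 n) y)) (t : ℝ) :
    hatScale _ t (dotS g y e) = t • dotS g y e := by
  unfold dotS coframe
  simp only [map_smul, map_sum, hatScale_hatMul, ExteriorAlgebra.map_apply_ι, LinearMap.smul_apply,
    LinearMap.id_apply]
  simp only [← hatMulLin_apply, map_smul, smul_comm _ t, ← Finset.smul_sum]

lemma hatScale_dotR (g : SmoothMetric n X) (y : Boundary n X)
    (e : Module.Basis (Fin n) ℝ (TangentSpace (𝓡 n) y)) (t : ℝ) :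
    hatScale _ t (dotR g y e) = t ^ 2 • dotR g y e := by
  unfold dotR coframe
  simp only [map_smul, map_sum, hatScale_hatMul, map_mul, ExteriorAlgebra.map_apply_ι,
    LinearMap.smul_apply, LinearMap.id_apply]
  simp only [← hatMulLin_apply, map_smul, smul_mul_smul_comm, ← Finset.smul_sum, ← sq]
  rw [smul_comm]


lemma secondaryFormIn_eq_of_smul (o : ManifoldOrientation n X) (hs : 0 < s)
    (hg : ∀ (x : X) (v w : TangentSpace (𝓡∂ (n + 1)) x),
      g₂.inner x v w = s * g₁.inner x v w) {y : Boundary n X}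
    {e e' : Module.Basis (Fin n) ℝ (TangentSpace (𝓡 n) y)} (he : IsOrthonormalFrame g₁ y e)
    (he' : IsOrthonormalFrame g₂ y e') :
    secondaryFormIn o g₁ y e = secondaryFormIn o g₂ y e' := by
  have ht := Real.sqrt_pos.2 hs
  have hR : dotR g₂ y e' = hatScale _ (√s) (dotR g₁ y e) := by
    -- Here `e` need not be orthonormal for `g₂`. The factor s = (√s)² matches the two hatted
    -- covectors.
    rw [dotR_eq_of_basis g₂ y e' e, dotR_smul hs hg, hatScale_dotR, Real.sq_sqrt hs.le]
  have hS : dotS g₂ y e' = hatScale _ (√s) (dotS g₁ y e) := by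
    rw [dotS_eq_of_basis g₂ y e' e, dotS_smul hs hg, hatScale_dotS]
  have hsign := frameSign_changeBasis o (inv_pos.2 ht) (unitNormal_smul hs hg y) e e'
  rw [abs_det_toMatrix_orthonormal hs hg he he'] at hsign
  unfold secondaryFormIn
  rw [hR, hS, ← hatScale_nilExp_mul_finsum ht.ne']
  exact (berezin_hatScale_changeBasis e e' ht.ne' hsign _).symm

end Scaling

end Boundary
end BoundaryAnomaly
end

theorem proposition3p1 (n : ℕ) (hn : Odd (n + 1)) {X : Type*} [TopologicalSpace X] [T2Space X]
    [CompactSpace X] [ChartedSpace (EuclideanHalfSpace (n + 1)) X]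
    [IsManifold (𝓡∂ (n + 1)) ∞ X] (o : BoundaryAnomaly.ManifoldOrientation n X)
    (g₁ g₂ : BoundaryAnomaly.SmoothMetric n X) (s : ℝ) (hs : 0 < s)
    (hg : ∀ (x : X) (v w : TangentSpace (𝓡∂ (n + 1)) x),
      g₂.inner x v w = s * g₁.inner x v w) :
    BoundaryAnomaly.secondaryForm o g₁ = BoundaryAnomaly.secondaryForm o g₂ :=
  funext fun y => BoundaryAnomaly.secondaryFormIn_eq_of_smul o hs hg
    (BoundaryAnomaly.exists_orthonormalFrame g₁ y).choose_spec
    (BoundaryAnomaly.exists_orthonormalFrame g₂ y).choose_spec
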